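/- Let $T$ be a finite tree on $n$ vertices. For an edge $e=uv$ of $T$ let $n_u(e)$ and $n_v(e)$ be the numbers of vertices of the components of $T-e$ containing $u$ and $v$ respectively, and put $\mu(e)=\min\{n_u(e),n_v(e)\}$. For $1\le i\le\lfloor n/2\rfloor$ let $r_i(T)$ be the number of edges $e$ of $T$ with $\mu(e)=i$, and let $\mathbf r(T)=(r_1(T),\ldots,r_{\lfloor n/2\rfloor}(T))$ be the edge division vector of $T$. For trees $T,T'$ on $n$ vertices write $T\preceq T'$ if $\sum_{i=k}^{\lfloor n/2\rfloor} r_i(T)\le\sum_{i=k}^{\lfloor n/2\rfloor} r_i(T')$ for every $k=1,\ldots,\lfloor n/2\rfloor$, and $T\approx T'$ if $\mathbf r(T)=\mathbf r(T')$. Let $\mathcal T_n(q)$ be the set of trees on $n$ vertices with exactly $q$ pendent vertices (vertices of degree $1$). For $q\le n-2$ let $CP_{n;\lfloor q/2\rfloor,\lceil q/2\rceil}$ be the graph obtained from the path $P_{n-q}=v_1v_2\cdots v_{n-q}$ by attaching $\lfloor q/2\rfloor$ pendent vertices to $v_1$ and $\lceil q/2\rceil$ pendent vertices to $v_{n-q}$.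 **Theorem.** Let $2<q<n-1$. Then $CP_{n;\lfloor q/2\rfloor,\lceil q/2\rceil}\in\mathcal T_n(q)$, and every $T\in\mathcal T_n(q)$ satisfies $$T\preceq CP_{n;\lfloor q/2\rfloor,\lceil q/2\rceil},$$ with equality, i.e. $T\approx CP_{n;\lfloor q/2\rfloor,\lceil q/2\rceil}$, if and only if $T$ is isomorphic to $CP_{n;\lfloor q/2\rfloor,\lceil q/2\rceil}$. -/

import Mathlib

/-- `v` is a pendent vertex of `G`: it has degree `1`. -/
def IsPendent {V : Type*} (G : SimpleGraph V) (v : V) : Prop :=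
  (G.neighborSet v).ncard = 1

/-- `T` belongs to `𝒯ₙ(q)`: it is a (finite) tree with `n` vertices, exactly `q` of them pendent. -/
structure IsTreeWithPendents {V : Type*} (n q : ℕ) (T : SimpleGraph V) : Prop where
  finite : Finite V
  isTree : T.IsTree
  card_vertices : Nat.card V = n
  card_pendent : {v : V | IsPendent T v}.ncard = q

/-- `n_u(e)` for the edge `e = uv`: the number of vertices of the component of `T - e`
containing `u`. -/
noncomputable def sideCard {V : Type*} (T : SimpleGraph V) (u v : V) : ℕ :=
  {w : V | (T.deleteEdges {s(u, v)}).Reachable u w}.ncard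

/-- `μ(e) = min {n_u(e), n_v(e)}` for `e = uv`. -/
noncomputable def edgeMu {V : Type*} (T : SimpleGraph V) (e : Sym2 V) : ℕ :=
  Sym2.lift ⟨fun u v => min (sideCard T u v) (sideCard T v u), fun _ _ => min_comm _ _⟩ e

/-- `r_i(T)`: the number of edges `e` of `T` with `μ(e) = i`. -/
noncomputable def edgeDivision {V : Type*} (T : SimpleGraph V) (i : ℕ) : ℕ :=
  {e : Sym2 V | e ∈ T.edgeSet ∧ edgeMu T e = i}.ncard

/-- The relation `T ⪯ T'` between trees on `n` vertices: for all `1 ≤ k ≤ ⌊n/2⌋`,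
`∑_{i=k}^{⌊n/2⌋} r_i(T) ≤ ∑_{i=k}^{⌊n/2⌋} r_i(T')`. -/
def EdgeDivisionLE {V W : Type*} (n : ℕ) (T : SimpleGraph V) (T' : SimpleGraph W) : Prop :=
  ∀ k ∈ Finset.Icc 1 (n / 2),
    ∑ i ∈ Finset.Icc k (n / 2), edgeDivision T i ≤ ∑ i ∈ Finset.Icc k (n / 2), edgeDivision T' i

/-- The relation `T ≈ T'` between trees on `n` vertices: the edge division vectors
`(r_1, …, r_{⌊n/2⌋})` of `T` and `T'` coincide. -/
def EdgeDivisionEq {V W : Type*} (n : ℕ) (T : SimpleGraph V) (T' : SimpleGraph W) : Prop :=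
  ∀ i ∈ Finset.Icc 1 (n / 2), edgeDivision T i = edgeDivision T' i

/-- Adjacency of the double star path: the vertices `Sum.inl i` form the path `v_1 ⋯ v_k`
(`v_{i+1}` is `Sum.inl i`), the `a` vertices `Sum.inr (Sum.inl x)` are attached to `v_1` and the
`b` vertices `Sum.inr (Sum.inr y)` are attached to `v_k`. -/
def DoubleStarPathAdj (k a b : ℕ) : Fin k ⊕ (Fin a ⊕ Fin b) → Fin k ⊕ (Fin a ⊕ Fin b) → Prop
  | Sum.inl i, Sum.inl j => i.val + 1 = j.val ∨ j.val + 1 = i.val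
  | Sum.inl i, Sum.inr (Sum.inl _) => i.val = 0
  | Sum.inr (Sum.inl _), Sum.inl i => i.val = 0
  | Sum.inl i, Sum.inr (Sum.inr _) => i.val + 1 = k
  | Sum.inr (Sum.inr _), Sum.inl i => i.val + 1 = k
  | Sum.inr _, Sum.inr _ => False

/-- The double star path `CP_{n;a,b}` with `n = k + a + b`: the path `P_k = v_1 ⋯ v_k` with `a`
pendent vertices attached to `v_1` and `b` pendent vertices attached to `v_k`. -/
def doubleStarPath (k a b : ℕ) : SimpleGraph (Fin k ⊕ (Fin a ⊕ Fin b)) where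
  Adj := DoubleStarPathAdj k a b
  symm := by
    constructor
    rintro (i | x | x) (j | y | y) h <;> simp only [DoubleStarPathAdj] at h ⊢ <;> tauto
  loopless := by
    constructor
    rintro (i | x | x) h <;> simp [DoubleStarPathAdj] at h

/-! Write `H_k` for the set of edges with `μ ≥ k`; its size is the tail sum of the edge division
vector. If `H_k` is nonempty, walk from one of its edges in both directions as far as possible: this
gives two disjoint sides, each with at least `k` vertices and containing no edge of `H_k`. Each side
is connected, so it holds at least `k - 1` edges, whence `|H_k| ≤ (n - 1) - 2(k - 1)`
(`ncard_heavyEdges_add_le`). Moreover `r_1 = q`, so `|H_k| ≤ |H_2| = n - 1 - q` for `k ≥ 2`. The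
balanced double star path reaches the smaller of these bounds (`le_ncard_heavyEdges_dsp`).

In the equality case no edge has `2 ≤ μ ≤ ⌊q/2⌋`. For `k = 2` the two extremal sides are stars whose
leaves are pendent in `T`, so their centres carry at least `⌊q/2⌋` pendent vertices each. A split
missing one pendent vertex (`q` odd) would give two edges with `μ = ⌊q/2⌋ + 1`, where the double
star path has at most one. So every pendent vertex hangs on one of two centres, and the remaining
vertices form the path between them (`nonempty_iso_of_heavyEdges`). -/

namespace EdgeDivision

open SimpleGraph

variable {V W : Type*} {T : SimpleGraph V}

/-! ### The two components of a tree minus an edge -/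

/-- The vertex set of the component of `T - uv` containing `u`. -/
def side (T : SimpleGraph V) (u v : V) : Set V :=
  {w : V | (T.deleteEdges {s(u, v)}).Reachable u w}

/-- The edges of `T` with both ends in `S`. -/
def innerEdges (T : SimpleGraph V) (S : Set V) : Set (Sym2 V) :=
  {e | e ∈ T.edgeSet ∧ ∀ x ∈ e, x ∈ S}

/-- The edges `e` of `T` with `k ≤ μ(e)`. -/
def heavyEdges (T : SimpleGraph V) (k : ℕ) : Set (Sym2 V) :=
  {e | e ∈ T.edgeSet ∧ k ≤ edgeMu T e}

theorem edgeMu_mk (T : SimpleGraph V) (u v : V) :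
    edgeMu T s(u, v) = min (side T u v).ncard (side T v u).ncard := rfl

theorem left_mem_side (u v : V) : u ∈ side T u v := Reachable.refl _

theorem mem_side_of_adj {u v a b : V} (ha : a ∈ side T u v) (hab : T.Adj a b)
    (hne : s(a, b) ≠ s(u, v)) : b ∈ side T u v :=
  Reachable.trans ha (Adj.reachable (deleteEdges_adj.2 ⟨hab, by simpa using hne⟩))

theorem side_subset_of_closed {u v : V} {S : Set V} (hu : u ∈ S)
    (hS : ∀ a b, T.Adj a b → s(a, b) ≠ s(u, v) → a ∈ S → b ∈ S) : side T u v ⊆ S := by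
  rintro w ⟨p⟩
  by_contra hw
  obtain ⟨d, -, h1, h2⟩ := p.exists_boundary_dart S hu hw
  have hd := d.adj
  rw [deleteEdges_adj] at hd
  exact h2 (hS _ _ hd.1 (by simpa using hd.2) h1)

theorem right_notMem_side (hT : T.IsAcyclic) {u v : V} (h : T.Adj u v) : v ∉ side T u v :=
  isBridge_iff.1 (isAcyclic_iff_forall_adj_isBridge.1 hT h)

theorem compl_side (hT : T.IsTree) {u v : V} (h : T.Adj u v) : (side T u v)ᶜ = side T v u := by
  apply Set.Subset.antisymm
  · intro w hw
    by_contra hw'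
    have hp := (hT.connected.preconnected u w).some
    obtain ⟨d, -, h1, h2⟩ := hp.exists_boundary_dart (side T u v ∪ side T v u)
      (Or.inl (left_mem_side u v)) (by
        rintro (h3 | h3)
        · exact hw h3
        · exact hw' h3)
    apply h2
    by_cases he : s(d.fst, d.snd) = s(u, v)
    · rcases Sym2.eq_iff.1 he with ⟨-, h3⟩ | ⟨-, h3⟩
      · exact Or.inr (h3 ▸ left_mem_side _ _)
      · exact Or.inl (h3 ▸ left_mem_side _ _)
    · rcases h1 with h1 | h1
      · exact Or.inl (mem_side_of_adj h1 d.adj he)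
      · exact Or.inr (mem_side_of_adj h1 d.adj (by rwa [Sym2.eq_swap (a := v)]))
  · intro w hw hw'
    have h1 : (T.deleteEdges {s(u, v)}).Reachable v w := by
      have : (T.deleteEdges {s(v, u)}).Reachable v w := hw
      rwa [Sym2.eq_swap] at this
    exact right_notMem_side hT.isAcyclic h (Reachable.trans hw' h1.symm)

theorem eq_of_adj_of_mem_side_of_notMem {u v a b : V} (hT : T.IsAcyclic) (h : T.Adj u v)
    (hab : T.Adj a b) (ha : a ∈ side T u v) (hb : b ∉ side T u v) : a = u ∧ b = v := by
  by_cases he : s(a, b) = s(u, v)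
  · rcases Sym2.eq_iff.1 he with h1 | ⟨h1, -⟩
    · exact h1
    · exact absurd (h1 ▸ ha) (right_notMem_side hT h)
  · exact absurd (mem_side_of_adj ha hab he) hb

/-- A set and its complement that are joined by `uv` alone are each closed under the other edges, so
each contains its side; the sides being complementary, both inclusions are equalities. -/
theorem side_eq_of_cut (hT : T.IsTree) {u v : V} (h : T.Adj u v) {S : Set V} (hu : u ∈ S)
    (hv : v ∉ S) (hS : ∀ a b, T.Adj a b → a ∈ S → b ∉ S → s(a, b) = s(u, v)) :
    side T u v = S := by
  apply Set.Subset.antisymm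
  · refine side_subset_of_closed hu fun a b hab hne ha => ?_
    by_contra hb
    exact hne (hS a b hab ha hb)
  · rw [← Set.compl_subset_compl, compl_side hT h]
    refine side_subset_of_closed hv fun a b hab hne ha hb => hne ?_
    rw [Sym2.eq_swap, hS b a hab.symm hb ha, Sym2.eq_swap]

/-- The only exit from the larger side is through `v`, which the smaller one avoids; strictness
comes from `y`. -/
theorem side_ssubset_of_notMem (hT : T.IsTree) {u v x y : V} (h : T.Adj u v) (hxy : T.Adj x y)
    (hx : x ∈ side T u v) (hy : y ∈ side T u v) (hv : v ∉ side T x y) :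
    side T x y ⊂ side T u v := by
  have hsub : side T x y ⊆ side T u v ∩ side T x y := by
    refine side_subset_of_closed ⟨hx, left_mem_side x y⟩ fun a b hab hne ha => ?_
    have hb := mem_side_of_adj ha.2 hab hne
    refine ⟨?_, hb⟩
    by_contra hbu
    exact hv ((eq_of_adj_of_mem_side_of_notMem hT.isAcyclic h hab ha.1 hbu).2 ▸ hb)
  exact ⟨fun w hw => (hsub hw).1, fun hsub => right_notMem_side hT.isAcyclic hxy (hsub hy)⟩

/-! ### Light sides and the upper bound on heavy edges -/

theorem exists_side_ssubset (hT : T.IsTree) {u v : V} (h : T.Adj u v) {e : Sym2 V}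
    (he : e ∈ innerEdges T (side T u v)) :
    ∃ x y, T.Adj x y ∧ s(x, y) = e ∧ side T x y ⊂ side T u v := by
  induction e using Sym2.ind with
  | _ x y =>
    obtain ⟨hxy, hin⟩ := he
    have hxy : T.Adj x y := hxy
    have hx := hin x (by simp)
    have hy := hin y (by simp)
    by_cases hv : v ∈ side T x y
    · refine ⟨y, x, hxy.symm, Sym2.eq_swap, side_ssubset_of_notMem hT h hxy.symm hy hx ?_⟩
      rw [← compl_side hT hxy]
      exact fun h => h hv
    · exact ⟨x, y, hxy, rfl, side_ssubset_of_notMem hT h hxy hx hy hv⟩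

/-- Descent on the size of the side: a heavy edge inside it has a strictly smaller side, the one
away from `v`. -/
theorem exists_light_side [Finite V] (hT : T.IsTree) {k : ℕ} {u v : V} (h : T.Adj u v)
    (hk : k ≤ edgeMu T s(u, v)) :
    ∃ x y, T.Adj x y ∧ k ≤ edgeMu T s(x, y) ∧ side T x y ⊆ side T u v ∧
      Disjoint (heavyEdges T k) (innerEdges T (side T x y)) := by
  induction hm : (side T u v).ncard using Nat.strong_induction_on generalizing u v with
  | _ m ih =>
    by_cases hd : Disjoint (heavyEdges T k) (innerEdges T (side T u v))
    · exact ⟨u, v, h, hk, subset_rfl, hd⟩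
    · obtain ⟨e, he, hi⟩ := Set.not_disjoint_iff.1 hd
      obtain ⟨x, y, hxy, rfl, hss⟩ := exists_side_ssubset hT h hi
      obtain ⟨x', y', h1, h2, h3, h4⟩ :=
        ih _ (hm ▸ Set.ncard_lt_ncard hss (Set.toFinite _)) hxy he.2 rfl
      exact ⟨x', y', h1, h2, h3.trans hss.1, h4⟩

theorem disjoint_side (hT : T.IsTree) {u v : V} (h : T.Adj u v) :
    Disjoint (side T u v) (side T v u) := by
  rw [← compl_side hT h]
  exact disjoint_compl_right

theorem exists_two_light_sides [Finite V] (hT : T.IsTree) {k : ℕ}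
    (hne : (heavyEdges T k).Nonempty) :
    ∃ u v x y, T.Adj u v ∧ T.Adj x y ∧ k ≤ edgeMu T s(u, v) ∧ k ≤ edgeMu T s(x, y) ∧
      Disjoint (side T u v) (side T x y) ∧
      Disjoint (heavyEdges T k) (innerEdges T (side T u v)) ∧
      Disjoint (heavyEdges T k) (innerEdges T (side T x y)) := by
  obtain ⟨e, he⟩ := hne
  induction e using Sym2.ind with
  | _ c d =>
    have hcd : T.Adj c d := he.1
    obtain ⟨u, v, h1, h2, h3, h4⟩ := exists_light_side hT hcd he.2
    obtain ⟨x, y, h5, h6, h7, h8⟩ := exists_light_side hT hcd.symm (k := k)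
      (by rw [Sym2.eq_swap]; exact he.2)
    exact ⟨u, v, x, y, h1, h5, h2, h6, (disjoint_side hT hcd).mono h3 h7, h4, h8⟩

/-- A side is a connected component of `T - uv`, and a connected graph has at least one edge fewer
than vertices. -/
theorem ncard_side_le [Finite V] (u v : V) :
    (side T u v).ncard ≤ (innerEdges T (side T u v)).ncard + 1 := by
  let C := (T.deleteEdges {s(u, v)}).connectedComponentMk u
  have hC : C.supp = side T u v := by
    ext w
    rw [ConnectedComponent.mem_supp_iff, ConnectedComponent.eq]
    exact ⟨fun h => h.symm, fun h => h.symm⟩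
  have h1 := C.connected_toSimpleGraph.card_vert_le_card_edgeSet_add_one
  have h2 : Nat.card C = (side T u v).ncard := by
    rw [← hC]; rfl
  rw [h2] at h1
  refine h1.trans (Nat.add_le_add_right ?_ 1)
  rw [Nat.card_coe_set_eq]
  refine Set.ncard_le_ncard_of_injOn (Sym2.map Subtype.val) ?_
    (Sym2.map.injective Subtype.val_injective).injOn (Set.toFinite _)
  intro e he
  induction e using Sym2.ind with
  | _ a b =>
    have hab : (T.deleteEdges {s(u, v)}).Adj a b := he
    refine ⟨(deleteEdges_adj.1 hab).1, fun x hx => ?_⟩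
    rw [← hC]
    rcases Sym2.mem_iff.1 hx with rfl | rfl
    · exact a.2
    · exact b.2

theorem ncard_edgeSet [Finite V] (hT : T.IsTree) : T.edgeSet.ncard + 1 = Nat.card V := by
  rw [← Nat.card_coe_set_eq]
  exact (isTree_iff_connected_and_card.1 hT).2

theorem le_ncard_side_of_le_edgeMu {k : ℕ} {u v : V} (hk : k ≤ edgeMu T s(u, v)) :
    k ≤ (side T u v).ncard :=
  hk.trans (min_le_left _ _)

/-- The heavy edges and the inner edges of two disjoint light sides are three disjoint sets among `n
- 1` edges. -/
theorem ncard_heavyEdges_add_le [Finite V] (hT : T.IsTree) {k : ℕ}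
    (hne : (heavyEdges T k).Nonempty) :
    (heavyEdges T k).ncard + 2 * k ≤ Nat.card V + 1 := by
  obtain ⟨u, v, x, y, huv, hxy, hk1, hk2, hd, hd1, hd2⟩ := exists_two_light_sides hT hne
  have h1 := ncard_side_le (T := T) u v
  have h2 := ncard_side_le (T := T) x y
  have h3 := le_ncard_side_of_le_edgeMu hk1
  have h4 := le_ncard_side_of_le_edgeMu hk2
  have hdi : Disjoint (innerEdges T (side T u v)) (innerEdges T (side T x y)) := by
    rw [Set.disjoint_left]
    intro e he he'
    induction e using Sym2.ind with
    | _ a b => exact Set.disjoint_left.1 hd (he.2 a (by simp)) (he'.2 a (by simp))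
  have h5 : (heavyEdges T k ∪ (innerEdges T (side T u v) ∪ innerEdges T (side T x y))).ncard ≤
      T.edgeSet.ncard := by
    refine Set.ncard_le_ncard ?_ (Set.toFinite _)
    rintro e (he | he | he) <;> exact he.1
  rw [Set.ncard_union_eq (Set.disjoint_union_right.2 ⟨hd1, hd2⟩) (Set.toFinite _)
    (Set.toFinite _), Set.ncard_union_eq hdi (Set.toFinite _) (Set.toFinite _)] at h5
  have h6 := ncard_edgeSet hT
  omega

/-! ### Tail sums, pendent vertices and `r_1` -/

theorem ncard_side_add [Finite V] (hT : T.IsTree) {u v : V} (h : T.Adj u v) :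
    (side T u v).ncard + (side T v u).ncard = Nat.card V := by
  rw [← compl_side hT h, Set.ncard_add_ncard_compl]

theorem edgeMu_le [Finite V] (hT : T.IsTree) {e : Sym2 V} (he : e ∈ T.edgeSet) :
    edgeMu T e ≤ Nat.card V / 2 := by
  induction e using Sym2.ind with
  | _ a b =>
    have := ncard_side_add hT (u := a) (v := b) he
    rw [edgeMu_mk]
    omega

theorem one_le_ncard_side [Finite V] (u v : V) : 1 ≤ (side T u v).ncard :=
  (Set.ncard_pos (Set.toFinite _)).2 ⟨u, left_mem_side u v⟩

theorem one_le_edgeMu [Finite V] (e : Sym2 V) : 1 ≤ edgeMu T e := by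
  induction e using Sym2.ind with
  | _ a b => exact le_min (one_le_ncard_side a b) (one_le_ncard_side b a)

theorem sum_edgeDivision [Finite V] (hT : T.IsTree) (k : ℕ) :
    ∑ i ∈ Finset.Icc k (Nat.card V / 2), edgeDivision T i = (heavyEdges T k).ncard := by
  classical
  have hfin : (heavyEdges T k).Finite := Set.toFinite _
  rw [Set.ncard_eq_toFinset_card _ hfin, Finset.card_eq_sum_card_fiberwise (f := edgeMu T)
    (t := Finset.Icc k (Nat.card V / 2))]
  · refine Finset.sum_congr rfl fun i hi => ?_
    rw [edgeDivision, ← Set.ncard_coe_finset]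
    congr 1
    ext e
    have := (Finset.mem_Icc.1 hi).1
    simp only [Set.mem_ofPred_eq, Finset.coe_filter, Set.Finite.mem_toFinset, heavyEdges]
    constructor
    · rintro ⟨h1, rfl⟩; exact ⟨⟨h1, this⟩, rfl⟩
    · rintro ⟨h1, h2⟩; exact ⟨h1.1, h2⟩
  · intro e he
    have he : e ∈ heavyEdges T k := by simpa using he
    simpa using ⟨he.2, edgeMu_le hT he.1⟩

theorem side_eq_singleton_of_isPendent {u v : V} (h : T.Adj u v) (hu : IsPendent T u) :
    side T u v = {u} := by
  obtain ⟨w, hw⟩ := Set.ncard_eq_one.1 hu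
  have hn : ∀ b, T.Adj u b → b = v := by
    intro b hb
    have h1 : b ∈ T.neighborSet u := hb
    have h2 : v ∈ T.neighborSet u := h
    rw [hw] at h1 h2
    exact h1.trans h2.symm
  refine Set.Subset.antisymm (side_subset_of_closed rfl ?_) (by simpa using left_mem_side u v)
  rintro a b hab hne rfl
  exact absurd (by rw [hn b hab]) hne

theorem isPendent_of_adj_eq {u v : V} (h : T.Adj u v) (hn : ∀ b, T.Adj u b → b = v) :
    IsPendent T u :=
  Set.ncard_eq_one.2 ⟨v, Set.ext fun b => ⟨hn b, fun hb => (hb : b = v) ▸ h⟩⟩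

theorem _root_.IsPendent.eq_of_adj {u a b : V} (hu : IsPendent T u) (ha : T.Adj u a) (hb : T.Adj u b) :
    a = b := by
  obtain ⟨w, hw⟩ := Set.ncard_eq_one.1 hu
  have h1 : a ∈ T.neighborSet u := ha
  have h2 : b ∈ T.neighborSet u := hb
  rw [hw] at h1 h2
  exact h1.trans h2.symm

theorem isPendent_iff_ncard_side {u v : V} (h : T.Adj u v) :
    IsPendent T u ↔ (side T u v).ncard = 1 := by
  refine ⟨fun hu => by rw [side_eq_singleton_of_isPendent h hu, Set.ncard_singleton], fun hs => ?_⟩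
  obtain ⟨w, hw⟩ := Set.ncard_eq_one.1 hs
  refine isPendent_of_adj_eq h fun b hb => ?_
  by_contra hbv
  have h1 : b ∈ side T u v := mem_side_of_adj (left_mem_side u v) hb (by
    simp only [ne_eq, Sym2.eq_iff, not_or, not_and]
    exact ⟨fun _ => hbv, fun h1 => absurd h1 h.ne⟩)
  have h2 := left_mem_side (T := T) u v
  rw [hw] at h1 h2
  exact hb.ne (h2.trans h1.symm)

/-- For `k = 1` every edge is heavy, so a light side has no inner edge and is a single pendent
vertex. -/
theorem exists_isPendent_mem_side [Finite V] (hT : T.IsTree) {u v : V} (h : T.Adj u v) :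
    ∃ z ∈ side T u v, IsPendent T z := by
  obtain ⟨x, y, hxy, -, hsub, hd⟩ := exists_light_side hT h (one_le_edgeMu _)
  refine ⟨x, hsub (left_mem_side x y), (isPendent_iff_ncard_side hxy).2 ?_⟩
  have h1 : innerEdges T (side T x y) = ∅ := by
    rw [Set.eq_empty_iff_forall_notMem]
    exact fun e he => Set.disjoint_left.1 hd ⟨he.1, one_le_edgeMu e⟩ he
  have h2 := ncard_side_le (T := T) x y
  rw [h1, Set.ncard_empty] at h2
  exact le_antisymm h2 (one_le_ncard_side x y)

theorem edgeMu_eq_one_iff [Finite V] {u v : V} (h : T.Adj u v) :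
    edgeMu T s(u, v) = 1 ↔ IsPendent T u ∨ IsPendent T v := by
  rw [isPendent_iff_ncard_side h, isPendent_iff_ncard_side h.symm, edgeMu_mk]
  have := one_le_ncard_side (T := T) u v
  have := one_le_ncard_side (T := T) v u
  omega

theorem edgeDivision_one [Finite V] (hT : T.IsTree) (hV : 3 ≤ Nat.card V) :
    edgeDivision T 1 = {v : V | IsPendent T v}.ncard := by
  have : Nontrivial V := Finite.one_lt_card_iff_nontrivial.1 (by omega)
  choose f hf using fun v => hT.connected.preconnected.exists_adj_of_nontrivial v
  symm
  refine Set.ncard_congr (fun v _ => s(v, f v)) (fun v hv => ?_) (fun a b ha hb hab => ?_) ?_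
  · exact ⟨hf v, (edgeMu_eq_one_iff (hf v)).2 (Or.inl hv)⟩
  · rcases Sym2.eq_iff.1 hab with h | ⟨h1, h2⟩
    · exact h.1
    · exfalso
      have hadj : T.Adj a b := h2 ▸ hf a
      have h3 := ncard_side_add hT hadj
      rw [(isPendent_iff_ncard_side hadj).1 ha,
        (isPendent_iff_ncard_side hadj.symm).1 hb] at h3
      omega
  · rintro e ⟨he, hm⟩
    induction e using Sym2.ind with
    | _ a b =>
      have he : T.Adj a b := he
      rcases (edgeMu_eq_one_iff he).1 hm with h | h
      · exact ⟨a, h, by rw [IsPendent.eq_of_adj h (hf a) he]⟩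
      · exact ⟨b, h, by rw [IsPendent.eq_of_adj h (hf b) he.symm, Sym2.eq_swap]⟩

theorem heavyEdges_one [Finite V] : heavyEdges T 1 = T.edgeSet :=
  Set.ext fun e => ⟨fun h => h.1, fun h => ⟨h, one_le_edgeMu e⟩⟩

theorem ncard_heavyEdges_succ [Finite V] (k : ℕ) :
    (heavyEdges T k).ncard = edgeDivision T k + (heavyEdges T (k + 1)).ncard := by
  rw [edgeDivision, ← Set.ncard_union_eq _ (Set.toFinite _) (Set.toFinite _)]
  · congr 1
    ext e
    simp only [heavyEdges, Set.mem_ofPred_eq, Set.mem_union, ← and_or_left]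
    exact and_congr_right fun _ => by omega
  · rw [Set.disjoint_left]
    rintro e ⟨-, h1⟩ ⟨-, h2⟩
    omega

theorem ncard_heavyEdges_two [Finite V] (hT : T.IsTree) (hV : 3 ≤ Nat.card V) :
    (heavyEdges T 2).ncard + {v : V | IsPendent T v}.ncard + 1 = Nat.card V := by
  rw [← ncard_edgeSet hT, ← heavyEdges_one, ncard_heavyEdges_succ 1, edgeDivision_one hT hV,
    Nat.add_comm (Set.ncard _)]

theorem heavyEdges_anti {j k : ℕ} (h : j ≤ k) : heavyEdges T k ⊆ heavyEdges T j :=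
  fun _ he => ⟨he.1, h.trans he.2⟩

/-! ### The double star path: tree structure, pendent vertices and `μ` -/

section DoubleStarPath

variable {k a b : ℕ}

theorem dsp_adj_inl {i j : Fin k} : (doubleStarPath k a b).Adj (.inl i) (.inl j) ↔
    i.val + 1 = j.val ∨ j.val + 1 = i.val := Iff.rfl

theorem dsp_adj_left {i : Fin k} {x : Fin a} :
    (doubleStarPath k a b).Adj (.inl i) (.inr (.inl x)) ↔ i.val = 0 := Iff.rfl

theorem dsp_adj_right {i : Fin k} {y : Fin b} :
    (doubleStarPath k a b).Adj (.inl i) (.inr (.inr y)) ↔ i.val + 1 = k := Iff.rfl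

theorem dsp_adj_inr {x y : Fin a ⊕ Fin b} :
    ¬ (doubleStarPath k a b).Adj (.inr x) (.inr y) := by
  intro h
  rcases x with x | x <;> rcases y with y | y <;> exact h

theorem dsp_connected (hk : 0 < k) : (doubleStarPath k a b).Connected := by
  have h1 : ∀ i (hi : i < k), (doubleStarPath k a b).Reachable (.inl ⟨0, hk⟩) (.inl ⟨i, hi⟩) := by
    intro i
    induction i with
    | zero => exact fun _ => Reachable.refl _
    | succ i ih =>
      exact fun hi => (ih (by omega)).trans (Adj.reachable (dsp_adj_inl.2 (Or.inl rfl)))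
  have h2 : ∀ v, (doubleStarPath k a b).Reachable (.inl ⟨0, hk⟩) v := by
    rintro (i | x | y)
    · exact h1 i i.2
    · exact Adj.reachable (dsp_adj_left.2 rfl)
    · exact (h1 (k - 1) (by omega)).trans (Adj.reachable (dsp_adj_right.2 (by simp; omega)))
  have : Nonempty (Fin k ⊕ (Fin a ⊕ Fin b)) := ⟨.inl ⟨0, hk⟩⟩
  exact ⟨fun u v => (h2 u).symm.trans (h2 v)⟩

/-- The neighbour of a vertex of the double star path that is next on the way to `v_1`. -/
def dspParent (hk : 0 < k) : Fin k ⊕ (Fin a ⊕ Fin b) → Fin k ⊕ (Fin a ⊕ Fin b)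
  | .inl i => .inl ⟨i - 1, by omega⟩
  | .inr (.inl _) => .inl ⟨0, hk⟩
  | .inr (.inr _) => .inl ⟨k - 1, by omega⟩

theorem dsp_edge_eq (hk : 0 < k) {e : Sym2 (Fin k ⊕ (Fin a ⊕ Fin b))}
    (he : e ∈ (doubleStarPath k a b).edgeSet) :
    (∃ i : Fin k, 0 < i.val ∧ e = s(.inl i, dspParent hk (.inl i))) ∨
      ∃ x : Fin a ⊕ Fin b, e = s(.inr x, dspParent hk (.inr x)) := by
  induction e using Sym2.ind with
  | _ u v =>
    have he : (doubleStarPath k a b).Adj u v := he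
    rcases u with i | x | x <;> rcases v with j | y | y
    · left
      rcases dsp_adj_inl.1 he with h | h
      · refine ⟨j, by omega, ?_⟩
        rw [Sym2.eq_swap]
        simp only [dspParent, ← h, Nat.add_sub_cancel]
      · refine ⟨i, by omega, ?_⟩
        simp only [dspParent, ← h, Nat.add_sub_cancel]
    · right
      refine ⟨.inl y, ?_⟩
      have h := dsp_adj_left.1 he
      rw [Sym2.eq_swap]
      simp only [dspParent, ← h]
    · right
      refine ⟨.inr y, ?_⟩
      have h := dsp_adj_right.1 he
      rw [Sym2.eq_swap]
      simp only [dspParent, ← h, Nat.add_sub_cancel]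
    · right
      refine ⟨.inl x, ?_⟩
      have h := dsp_adj_left.1 he.symm
      simp only [dspParent, ← h]
    · exact absurd he dsp_adj_inr
    · exact absurd he dsp_adj_inr
    · right
      refine ⟨.inr x, ?_⟩
      have h := dsp_adj_right.1 he.symm
      simp only [dspParent, ← h, Nat.add_sub_cancel]
    · exact absurd he dsp_adj_inr
    · exact absurd he dsp_adj_inr

theorem card_dsp_vertices : Nat.card (Fin k ⊕ (Fin a ⊕ Fin b)) = k + (a + b) := by simp

theorem dsp_isTree (hk : 0 < k) : (doubleStarPath k a b).IsTree := by
  refine isTree_iff_connected_and_card.2 ⟨dsp_connected hk, le_antisymm ?_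
    (dsp_connected hk).card_vert_le_card_edgeSet_add_one⟩
  rw [Nat.card_coe_set_eq]
  -- Every edge joins a vertex other than `v_1` to its parent, so there are at most `n - 1` edges.
  -- `v_1` is left out: truncated subtraction makes it its own parent.
  have h1 : (doubleStarPath k a b).edgeSet ⊆
      (fun v => s(v, dspParent hk v)) '' {(.inl ⟨0, hk⟩ : Fin k ⊕ (Fin a ⊕ Fin b))}ᶜ := by
    intro e he
    rcases dsp_edge_eq hk he with ⟨i, hi, rfl⟩ | ⟨x, rfl⟩
    · refine ⟨.inl i, fun h => ?_, rfl⟩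
      simp only [Set.mem_singleton_iff, Sum.inl.injEq] at h
      simp [h] at hi
    · exact ⟨.inr x, by simp, rfl⟩
  have h2 := (Set.ncard_le_ncard h1 (Set.toFinite _)).trans (Set.ncard_image_le (Set.toFinite _))
  have h3 := Set.ncard_add_ncard_compl {(.inl ⟨0, hk⟩ : Fin k ⊕ (Fin a ⊕ Fin b))}
  rw [Set.ncard_singleton] at h3
  omega

theorem dsp_isPendent_iff (hk : 2 ≤ k) (ha : 1 ≤ a) (hb : 1 ≤ b)
    (v : Fin k ⊕ (Fin a ⊕ Fin b)) :
    IsPendent (doubleStarPath k a b) v ↔ ∃ x, v = .inr x := by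
  constructor
  · intro h
    rcases v with i | x
    · exfalso
      by_cases h0 : i.val = 0
      · have := IsPendent.eq_of_adj h (dsp_adj_inl (j := ⟨1, hk⟩).2 (by simp [h0]))
          (dsp_adj_left (x := ⟨0, ha⟩).2 h0)
        simp at this
      · have h1 := dsp_adj_inl (a := a) (b := b) (i := i) (j := ⟨i.val - 1, by omega⟩).2
          (Or.inr (by simp; omega))
        by_cases hl : i.val + 1 = k
        · have := IsPendent.eq_of_adj h h1 (dsp_adj_right (y := ⟨0, hb⟩).2 hl)
          simp at this
        · have := IsPendent.eq_of_adj h h1 (dsp_adj_inl (j := ⟨i.val + 1, by omega⟩).2 (Or.inl rfl))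
          simp only [Sum.inl.injEq, Fin.mk.injEq] at this
          omega
    · exact ⟨x, rfl⟩
  · rintro ⟨x | y, rfl⟩
    · refine isPendent_of_adj_eq (v := .inl ⟨0, by omega⟩) (dsp_adj_left.2 rfl).symm ?_
      rintro (j | z) h
      · have := dsp_adj_left.1 h.symm
        simp only [← this]
      · exact absurd h dsp_adj_inr
    · refine isPendent_of_adj_eq (v := .inl ⟨k - 1, by omega⟩)
        (dsp_adj_right.2 (by simp; omega)).symm ?_
      rintro (j | z) h
      · have := dsp_adj_right.1 h.symm
        simp only [← this, Nat.add_sub_cancel]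
      · exact absurd h dsp_adj_inr

theorem dsp_ncard_pendent (hk : 2 ≤ k) (ha : 1 ≤ a) (hb : 1 ≤ b) :
    {v | IsPendent (doubleStarPath k a b) v}.ncard = a + b := by
  have : {v | IsPendent (doubleStarPath k a b) v} = Set.range Sum.inr := by
    ext v
    rw [Set.mem_ofPred_eq, dsp_isPendent_iff hk ha hb]
    exact ⟨fun ⟨x, h⟩ => ⟨x, h.symm⟩, fun ⟨x, h⟩ => ⟨x, h.symm⟩⟩
  rw [this, ← Set.image_univ, Set.ncard_image_of_injective _ Sum.inr_injective, Set.ncard_univ]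
  simp

theorem dsp_isTreeWithPendents (hk : 2 ≤ k) (ha : 1 ≤ a) (hb : 1 ≤ b) :
    IsTreeWithPendents (k + (a + b)) (a + b) (doubleStarPath k a b) :=
  ⟨inferInstance, dsp_isTree (by omega), card_dsp_vertices, dsp_ncard_pendent hk ha hb⟩

theorem dsp_ncard_side {i : ℕ} (hi : i + 1 < k) :
    (side (doubleStarPath k a b) (.inl ⟨i, by omega⟩) (.inl ⟨i + 1, hi⟩)).ncard = i + 1 + a := by
  have hS : side (doubleStarPath k a b) (.inl ⟨i, by omega⟩) (.inl ⟨i + 1, hi⟩) =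
      Set.range (Sum.elim (fun j : Fin (i + 1) => .inl ⟨j, by omega⟩)
        (fun x : Fin a => .inr (.inl x))) := by
    refine side_eq_of_cut (dsp_isTree (by omega)) (dsp_adj_inl.2 (Or.inl rfl))
      ⟨.inl ⟨i, by omega⟩, rfl⟩ ?_ ?_
    · rintro ⟨j | x, h⟩
      · simp only [Sum.elim_inl, Sum.inl.injEq, Fin.mk.injEq] at h
        omega
      · simp at h
    · rintro _ v h ⟨j | x, rfl⟩ hv
      · rcases v with l | y | y
        · have hl : i < l.val := by
            by_contra hl
            exact hv ⟨.inl ⟨l, by omega⟩, rfl⟩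
          have := dsp_adj_inl.1 h
          simp only at this
          have h1 : j.val = i := by omega
          have h2 : l = ⟨i + 1, hi⟩ := Fin.ext (by simp; omega)
          simp only [Sum.elim_inl, h1, h2]
        · exact absurd ⟨.inr y, rfl⟩ hv
        · have := dsp_adj_right.1 h
          simp only at this
          omega
      · rcases v with l | y
        · have := dsp_adj_left.1 h.symm
          exact absurd ⟨.inl ⟨0, by omega⟩, by simp [← this]⟩ hv
        · exact absurd h dsp_adj_inr
  have hinj : Function.Injective (Sum.elim (fun j : Fin (i + 1) =>
      (.inl ⟨j, by omega⟩ : Fin k ⊕ (Fin a ⊕ Fin b))) (fun x : Fin a => .inr (.inl x))) := by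
    rintro (j | x) (l | y) h
    · simp only [Sum.elim_inl, Sum.inl.injEq, Fin.mk.injEq] at h
      rw [Fin.ext h]
    · simp at h
    · simp at h
    · simpa using h
  rw [hS, ← Set.image_univ, Set.ncard_image_of_injective _ hinj, Set.ncard_univ]
  simp

theorem dsp_edgeMu {i : ℕ} (hi : i + 1 < k) :
    edgeMu (doubleStarPath k a b) s(.inl ⟨i, by omega⟩, .inl ⟨i + 1, hi⟩) =
      min (i + 1 + a) (k - 1 - i + b) := by
  have h := ncard_side_add (dsp_isTree (k := k) (a := a) (b := b) (by omega))
    (u := .inl ⟨i, by omega⟩) (v := .inl ⟨i + 1, hi⟩) (dsp_adj_inl.2 (Or.inl rfl))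
  rw [card_dsp_vertices] at h
  have h2 := dsp_ncard_side (a := a) (b := b) hi
  rw [edgeMu_mk]
  omega

theorem dsp_edge_eq_of_two_le (hk : 2 ≤ k) (ha : 1 ≤ a) (hb : 1 ≤ b)
    {e : Sym2 (Fin k ⊕ (Fin a ⊕ Fin b))} (he : e ∈ heavyEdges (doubleStarPath k a b) 2) :
    ∃ i, ∃ hi : i + 1 < k, e = s(.inl ⟨i, by omega⟩, .inl ⟨i + 1, hi⟩) := by
  rcases dsp_edge_eq (by omega) he.1 with ⟨i, hi, rfl⟩ | ⟨x, rfl⟩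
  · refine ⟨i - 1, by omega, ?_⟩
    rw [Sym2.eq_swap]
    have : i = ⟨i - 1 + 1, by omega⟩ := Fin.ext (by simp; omega)
    simp only [dspParent, ← this]
  · have h1 := (edgeMu_eq_one_iff he.1).2 (Or.inl ((dsp_isPendent_iff hk ha hb _).2 ⟨x, rfl⟩))
    exact absurd (he.2.trans_eq h1) (by omega)

/-- A non-pendent edge is a path edge, and each of its sides contains a path end with all its
pendent vertices. -/
theorem dsp_heavyEdges_eq (hk : 2 ≤ k) (ha : 1 ≤ a) (hab : a ≤ b) :
    heavyEdges (doubleStarPath k a b) 2 = heavyEdges (doubleStarPath k a b) (a + 1) := by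
  refine Set.Subset.antisymm (fun e he => ⟨he.1, ?_⟩) (heavyEdges_anti (by omega))
  obtain ⟨i, hi, rfl⟩ := dsp_edge_eq_of_two_le hk ha (by omega) he
  rw [dsp_edgeMu]
  omega

/-- As `a < b`, the value `a + 1` can only come from the side of `v_1`, hence from the first path
edge. -/
theorem dsp_edgeDivision_le_one (hk : 2 ≤ k) (ha : 1 ≤ a) (hab : a < b) :
    edgeDivision (doubleStarPath k a b) (a + 1) ≤ 1 := by
  refine (Set.ncard_le_one (Set.toFinite _)).2 ?_
  have h0 : ∀ e ∈ {e | e ∈ (doubleStarPath k a b).edgeSet ∧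
      edgeMu (doubleStarPath k a b) e = a + 1},
      e = s(.inl ⟨0, by omega⟩, .inl ⟨0 + 1, by omega⟩) := by
    rintro e ⟨he, hm⟩
    obtain ⟨i, hi, rfl⟩ := dsp_edge_eq_of_two_le hk ha (by omega) ⟨he, by omega⟩
    rw [dsp_edgeMu] at hm
    obtain rfl : i = 0 := by omega
    rfl
  exact fun e he f hf => (h0 e he).trans (h0 f hf).symm

/-- Exhibits `m` consecutive path edges with `μ ≥ j`. The balance `b ≤ a + 1` keeps this block
within the path. -/
theorem le_ncard_heavyEdges_dsp {m j : ℕ} (hab : a ≤ b) (hba : b ≤ a + 1)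
    (h1 : m + 1 ≤ k) (h2 : m + 2 * j ≤ k + a + b + 1) :
    m ≤ (heavyEdges (doubleStarPath k a b) j).ncard := by
  rcases Nat.eq_zero_or_pos m with rfl | hm
  · exact Nat.zero_le _
  -- The edge `v_{i+1}v_{i+2}` has `i + 1 + a` vertices on its left, so `j - (a + 1)`, truncated at
  -- `0`, is the first index where this reaches `j`.
  let f : Fin m → Sym2 (Fin k ⊕ (Fin a ⊕ Fin b)) := fun i =>
    s(.inl ⟨(j - (a + 1)) + i, by omega⟩, .inl ⟨(j - (a + 1)) + i + 1, by omega⟩)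
  have hf : Function.Injective f := by
    intro x y h
    simp only [f, Sym2.eq_iff, Sum.inl.injEq, Fin.mk.injEq] at h
    exact Fin.ext (by omega)
  calc m = (Set.range f).ncard := by
        rw [← Set.image_univ, Set.ncard_image_of_injective _ hf, Set.ncard_univ]; simp
    _ ≤ _ := by
        refine Set.ncard_le_ncard ?_ (Set.toFinite _)
        rintro _ ⟨i, rfl⟩
        refine ⟨(dsp_adj_inl (a := a) (b := b)).2 (Or.inl rfl), ?_⟩
        simp only [f]
        rw [dsp_edgeMu]
        omega

end DoubleStarPath

/-! ### Invariance under isomorphism -/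

section Iso

variable {T' : SimpleGraph W}

theorem side_iso (φ : T ≃g T') (u v : V) : side T' (φ u) (φ v) = φ '' side T u v := by
  apply Set.Subset.antisymm
  · refine side_subset_of_closed ⟨u, left_mem_side u v, rfl⟩ ?_
    rintro _ d hcd hne ⟨c, hc, rfl⟩
    obtain ⟨d, rfl⟩ := φ.surjective d
    refine ⟨d, mem_side_of_adj hc (φ.map_adj_iff.1 hcd) fun h => hne ?_, rfl⟩
    simpa using congrArg (Sym2.map φ) h
  · rw [Set.image_subset_iff]
    refine side_subset_of_closed (left_mem_side _ _) fun c d hcd hne hc => ?_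
    refine mem_side_of_adj hc (φ.map_adj_iff.2 hcd) fun h => hne ?_
    exact Sym2.map.injective φ.injective (by simpa using h)

theorem edgeMu_iso (φ : T ≃g T') (e : Sym2 V) : edgeMu T' (e.map φ) = edgeMu T e := by
  induction e using Sym2.ind with
  | _ u v =>
    rw [Sym2.map_mk, edgeMu_mk, edgeMu_mk, side_iso, side_iso,
      Set.ncard_image_of_injective _ φ.injective, Set.ncard_image_of_injective _ φ.injective]

theorem edgeDivision_iso (φ : T ≃g T') (i : ℕ) : edgeDivision T i = edgeDivision T' i := by
  refine Set.ncard_congr (fun e _ => e.map φ) (fun e he => ⟨?_, (edgeMu_iso φ e).trans he.2⟩)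
    (fun e f _ _ h => Sym2.map.injective φ.injective h) ?_
  · exact φ.map_mem_edgeSet_iff.2 he.1
  · rintro e ⟨he, hm⟩
    have hs : Sym2.map φ (e.map φ.symm) = e := by
      induction e using Sym2.ind with
      | _ c d => simp
    refine ⟨e.map φ.symm, ⟨φ.symm.map_mem_edgeSet_iff.2 he, ?_⟩, hs⟩
    rw [← hm, ← edgeMu_iso φ, hs]

end Iso

/-! ### Recognising a double star path -/

theorem disjoint_side_of_ne (hT : T.IsAcyclic) {w y z : V} (hy : T.Adj y w) (hz : T.Adj z w)
    (hyz : y ≠ z) : Disjoint (side T y w) (side T z w) := by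
  have h : side T z w ⊆ (side T y w)ᶜ ∩ side T z w := by
    refine side_subset_of_closed ⟨fun h => hyz ?_, left_mem_side z w⟩ fun c d hcd hne hc => ?_
    · exact (eq_of_adj_of_mem_side_of_notMem hT hy hz h (right_notMem_side hT hy)).1.symm
    · have hd := mem_side_of_adj hc.2 hcd hne
      refine ⟨fun h => right_notMem_side hT hz ?_, hd⟩
      exact (eq_of_adj_of_mem_side_of_notMem hT hy hcd.symm h hc.1).2 ▸ hc.2
  exact Set.disjoint_right.2 fun c hc => (h hc).1

theorem mem_support_of_side (hT : T.IsAcyclic) {u x y w : V} (p : T.Walk u x) (h : T.Adj y w)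
    (hu : u ∈ side T y w) (hx : x ∉ side T y w) : w ∈ p.support := by
  obtain ⟨d, hd, h1, h2⟩ := p.exists_boundary_dart _ hu hx
  rw [← (eq_of_adj_of_mem_side_of_notMem hT h d.adj h1 h2).2]
  exact p.dart_snd_mem_support_of_mem_darts hd

/-- Let `w ≠ u, x` be non-pendent. The branch at `w` behind any neighbour contains a pendent vertex,
hence also `u` or `x`, to which that vertex is attached. Two neighbours give disjoint branches, so
`w` separates `u` from `x`. -/
theorem mem_support_of_not_isPendent [Finite V] (hT : T.IsTree) {u x w : V} (hux : u ≠ x)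
    (hcov : ∀ z, IsPendent T z → T.Adj u z ∨ T.Adj x z) (p : T.Walk u x)
    (hw : ¬ IsPendent T w) : w ∈ p.support := by
  have hne : Nontrivial V := ⟨u, x, hux⟩
  by_cases hwu : w = u
  · exact hwu ▸ p.start_mem_support
  by_cases hwx : w = x
  · exact hwx ▸ p.end_mem_support
  have key : ∀ y, T.Adj y w → u ∈ side T y w ∨ x ∈ side T y w := by
    intro y hy
    obtain ⟨z, hz, hzp⟩ := exists_isPendent_mem_side hT hy
    rcases hcov z hzp with h | h
    · left
      by_contra hu
      exact hwu (eq_of_adj_of_mem_side_of_notMem hT.isAcyclic hy h.symm hz hu).2.symm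
    · right
      by_contra hx
      exact hwx (eq_of_adj_of_mem_side_of_notMem hT.isAcyclic hy h.symm hz hx).2.symm
  obtain ⟨y, hy⟩ := hT.connected.preconnected.exists_adj_of_nontrivial w
  obtain ⟨z, hz, hzy⟩ : ∃ z, T.Adj w z ∧ z ≠ y := by
    by_contra! h
    exact hw (isPendent_of_adj_eq hy h)
  have hd := disjoint_side_of_ne hT.isAcyclic hy.symm hz.symm hzy.symm
  rcases key y hy.symm with h1 | h1 <;> rcases key z hz.symm with h2 | h2
  · exact absurd h2 (Set.disjoint_left.1 hd h1)
  · exact mem_support_of_side hT.isAcyclic p hy.symm h1 (Set.disjoint_right.1 hd h2)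
  · exact mem_support_of_side hT.isAcyclic p hz.symm h2 (Set.disjoint_left.1 hd h1)
  · exact absurd h2 (Set.disjoint_left.1 hd h1)

/-- An interior vertex of a path has two distinct neighbours on it. -/
theorem not_isPendent_getVert {u x : V} (hu : ¬ IsPendent T u) (hx : ¬ IsPendent T x)
    {p : T.Walk u x} (hp : p.IsPath) {i : ℕ} (hi : i ≤ p.length) :
    ¬ IsPendent T (p.getVert i) := by
  rcases Nat.eq_zero_or_pos i with rfl | h0
  · simpa using hu
  rcases hi.eq_or_lt with rfl | hl
  · simpa using hx
  intro h
  obtain ⟨j, rfl⟩ := Nat.exists_eq_add_of_lt h0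
  rw [Nat.zero_add] at *
  have h1 := h.eq_of_adj (p.adj_getVert_succ (i := j) (by omega)).symm
    (p.adj_getVert_succ hl)
  have := hp.getVert_injOn (by simp; omega) (by simp; omega) h1
  omega

/-- The non-pendent vertices are exactly those of the path from `u` to `x`, so the path and the two
sets of pendent neighbours enumerate the vertices of `T`. -/
theorem nonempty_iso_doubleStarPath [Finite V] (hT : T.IsTree) {u x : V} (hux : u ≠ x)
    (hu : ¬ IsPendent T u) (hx : ¬ IsPendent T x)
    (hcov : ∀ z, IsPendent T z → T.Adj u z ∨ T.Adj x z) {k a b : ℕ}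
    (ha : {z | IsPendent T z ∧ T.Adj u z}.ncard = a)
    (hb : {z | IsPendent T z ∧ T.Adj x z}.ncard = b) (hV : Nat.card V = k + (a + b)) :
    Nonempty (T ≃g doubleStarPath k a b) := by
  obtain ⟨p, hp⟩ := hT.connected.exists_isPath u x
  have hk : k = p.length + 1 := by
    have h1 : {z | IsPendent T z} =
        {z | IsPendent T z ∧ T.Adj u z} ∪ {z | IsPendent T z ∧ T.Adj x z} := by
      ext z
      constructor
      · intro h
        exact (hcov z h).imp (fun h' => ⟨h, h'⟩) (fun h' => ⟨h, h'⟩)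
      · rintro (h | h) <;> exact h.1
    have h2 : Disjoint {z | IsPendent T z ∧ T.Adj u z} {z | IsPendent T z ∧ T.Adj x z} :=
      Set.disjoint_left.2 fun z h h' => hux (h.1.eq_of_adj h.2.symm h'.2.symm)
    have h3 : {z | IsPendent T z}ᶜ = Set.range fun i : Fin (p.length + 1) => p.getVert i := by
      ext w
      constructor
      · intro hw
        obtain ⟨i, h, hi⟩ := Walk.mem_support_iff_exists_getVert.1
          (mem_support_of_not_isPendent hT hux hcov p hw)
        exact ⟨⟨i, by omega⟩, h⟩
      · rintro ⟨i, rfl⟩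
        exact not_isPendent_getVert hu hx hp (by omega)
    have h4 : Function.Injective fun i : Fin (p.length + 1) => p.getVert i := fun i j h =>
      Fin.ext (hp.getVert_injOn (by simp; omega) (by simp; omega) h)
    have h5 := Set.ncard_add_ncard_compl {z | IsPendent T z}
    rw [h3, h1, Set.ncard_union_eq h2 (Set.toFinite _) (Set.toFinite _), ha, hb,
      ← Set.image_univ, Set.ncard_image_of_injective _ h4, Set.ncard_univ, Nat.card_fin] at h5
    omega
  subst hk
  let ea : Fin a ≃ {z | IsPendent T z ∧ T.Adj u z} :=
    (Finite.equivFinOfCardEq (by rw [Nat.card_coe_set_eq, ha])).symm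
  let eb : Fin b ≃ {z | IsPendent T z ∧ T.Adj x z} :=
    (Finite.equivFinOfCardEq (by rw [Nat.card_coe_set_eq, hb])).symm
  let F : Fin (p.length + 1) ⊕ (Fin a ⊕ Fin b) → V :=
    Sum.elim (fun i => p.getVert i) (Sum.elim (fun i => ea i) (fun i => eb i))
  have hF : Function.Surjective F := by
    intro w
    by_cases hw : IsPendent T w
    · rcases hcov w hw with h | h
      · exact ⟨.inr (.inl (ea.symm ⟨w, hw, h⟩)), by simp [F]⟩
      · exact ⟨.inr (.inr (eb.symm ⟨w, hw, h⟩)), by simp [F]⟩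
    · obtain ⟨i, h, hi⟩ := Walk.mem_support_iff_exists_getVert.1
        (mem_support_of_not_isPendent hT hux hcov p hw)
      exact ⟨.inl ⟨i, by omega⟩, h⟩
  have hFb : Function.Bijective F :=
    hF.bijective_of_nat_card_le (by rw [card_dsp_vertices, hV])
  have hhom : ∀ c d, (doubleStarPath (p.length + 1) a b).Adj c d → T.Adj (F c) (F d) := by
    have h1 : ∀ i (y : Fin a), (doubleStarPath (p.length + 1) a b).Adj (.inl i) (.inr (.inl y)) →
        T.Adj (F (.inl i)) (F (.inr (.inl y))) := by
      intro i y h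
      have := dsp_adj_left.1 h
      simpa [F, this] using (ea y).2.2
    have h2 : ∀ i (y : Fin b), (doubleStarPath (p.length + 1) a b).Adj (.inl i) (.inr (.inr y)) →
        T.Adj (F (.inl i)) (F (.inr (.inr y))) := by
      intro i y h
      have : i.val = p.length := by have := dsp_adj_right.1 h; omega
      simpa [F, this] using (eb y).2.2
    rintro (i | y | y) (j | z | z) h
    · rcases dsp_adj_inl.1 h with h | h
      · simpa [F, ← h] using p.adj_getVert_succ (i := i) (by omega)
      · simpa [F, ← h] using (p.adj_getVert_succ (i := j) (by omega)).symm
    · exact h1 i z h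
    · exact h2 i z h
    · exact (h1 j y h.symm).symm
    · exact absurd h dsp_adj_inr
    · exact absurd h dsp_adj_inr
    · exact (h2 j y h.symm).symm
    · exact absurd h dsp_adj_inr
    · exact absurd h dsp_adj_inr
  -- A tree is maximal among acyclic graphs, so the bijective homomorphism `F` onto the acyclic `T`
  -- also reflects adjacency.
  have hmax := (isTree_iff_maximal_isAcyclic.1
    (dsp_isTree (k := p.length + 1) (a := a) (b := b) (by omega))).2
  have hle : T.comap F ≤ doubleStarPath (p.length + 1) a b :=
    hmax.2 (hT.isAcyclic.of_comap ⟨F, hFb.1⟩) (fun c d h => hhom c d h)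
  let φ : doubleStarPath (p.length + 1) a b ≃g T :=
    { toEquiv := Equiv.ofBijective F hFb
      map_rel_iff' := fun {c d} => ⟨fun h => hle h, fun h => hhom c d h⟩ }
  exact ⟨φ.symm⟩

/-! ### The equality case -/

theorem not_isPendent_of_two_le [Finite V] {u v : V} (h : T.Adj u v)
    (h2 : 2 ≤ edgeMu T s(u, v)) : ¬ IsPendent T u := by
  intro hu
  have := (edgeMu_eq_one_iff h).2 (Or.inl hu)
  omega

/-- An edge from `u` into its side is not heavy, so it has `μ = 1` and ends in a pendent vertex: the
side is a star around `u`. -/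
theorem ncard_side_le_of_light [Finite V] {u v : V} (h : T.Adj u v)
    (h2 : 2 ≤ edgeMu T s(u, v))
    (hd : Disjoint (heavyEdges T 2) (innerEdges T (side T u v))) :
    (side T u v).ncard ≤ {z | IsPendent T z ∧ T.Adj u z}.ncard + 1 := by
  have hsub : side T u v ⊆ insert u {z | IsPendent T z ∧ T.Adj u z} := by
    refine side_subset_of_closed (Set.mem_insert _ _) ?_
    rintro c d hcd hne (rfl | ⟨hc, huc⟩)
    · refine Or.inr ⟨?_, hcd⟩
      have hds := mem_side_of_adj (left_mem_side c v) hcd hne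
      have h1 : s(c, d) ∉ heavyEdges T 2 := fun hh => Set.disjoint_left.1 hd hh
        ⟨hcd, fun z hz => by
          rcases Sym2.mem_iff.1 hz with rfl | rfl
          exacts [left_mem_side _ _, hds]⟩
      have h3 : ¬ 2 ≤ edgeMu T s(c, d) := fun h => h1 ⟨hcd, h⟩
      have h4 := one_le_edgeMu (T := T) s(c, d)
      exact ((edgeMu_eq_one_iff hcd).1 (by omega)).resolve_left (not_isPendent_of_two_le h h2)
    · exact Or.inl (hc.eq_of_adj hcd huc.symm)
  exact (Set.ncard_le_ncard hsub (Set.toFinite _)).trans (Set.ncard_insert_le _ _)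

theorem nonempty_iso_of_heavyEdges [Finite V] (hT : T.IsTree) {a q : ℕ} (ha : 1 ≤ a)
    (hq : {v | IsPendent T v}.ncard = q) (hqV : q + 2 ≤ Nat.card V)
    (hheavy : ∀ e ∈ heavyEdges T 2, a + 1 ≤ edgeMu T e)
    (hqa : q = 2 * a ∨ q = 2 * a + 1 ∧ edgeDivision T (a + 1) ≤ 1) :
    Nonempty (T ≃g doubleStarPath (Nat.card V - q) (q / 2) ((q + 1) / 2)) := by
  have hcard := ncard_heavyEdges_two hT (by omega)
  have hne : (heavyEdges T 2).Nonempty := by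
    rw [← Set.ncard_pos (Set.toFinite _)]
    omega
  obtain ⟨u, v, x, y, huv, hxy, hu2, hx2, hd, hdu, hdx⟩ := exists_two_light_sides hT hne
  have hux : u ≠ x := by
    rintro rfl
    exact Set.disjoint_left.1 hd (left_mem_side u v) (left_mem_side u y)
  have hup := not_isPendent_of_two_le huv hu2
  have hxp := not_isPendent_of_two_le hxy hx2
  have hu3 := ncard_side_le_of_light huv hu2 hdu
  have hx3 := ncard_side_le_of_light hxy hx2 hdx
  have hu4 := hheavy _ ⟨huv, hu2⟩
  have hx4 := hheavy _ ⟨hxy, hx2⟩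
  have hu5 := le_ncard_side_of_le_edgeMu hu4
  have hx5 := le_ncard_side_of_le_edgeMu hx4
  have hdis : Disjoint {z | IsPendent T z ∧ T.Adj u z} {z | IsPendent T z ∧ T.Adj x z} :=
    Set.disjoint_left.2 fun z h h' => hux (h.1.eq_of_adj h.2.symm h'.2.symm)
  have hsub : {z | IsPendent T z ∧ T.Adj u z} ∪ {z | IsPendent T z ∧ T.Adj x z} ⊆
      {z | IsPendent T z} := by
    rintro z (h | h) <;> exact h.1
  have hle := Set.ncard_le_ncard hsub (Set.toFinite _)
  have hcov : {z | IsPendent T z ∧ T.Adj u z}.ncard + {z | IsPendent T z ∧ T.Adj x z}.ncard = q →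
      ∀ z, IsPendent T z → T.Adj u z ∨ T.Adj x z := by
    intro h z hz
    have heq := Set.eq_of_subset_of_ncard_le hsub (by
      rw [Set.ncard_union_eq hdis (Set.toFinite _) (Set.toFinite _), h, hq]) (Set.toFinite _)
    have hz' : z ∈ {z | IsPendent T z} := hz
    rw [← heq] at hz'
    exact hz'.imp And.right And.right
  rw [Set.ncard_union_eq hdis (Set.toFinite _) (Set.toFinite _), hq] at hle
  -- Both counts are at least `a` and their sum is at most `q`. Apart from the two balanced splits,
  -- only `a + a` with `q = 2a + 1` is possible.
  by_cases h1 : {z | IsPendent T z ∧ T.Adj u z}.ncard = q / 2 ∧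
      {z | IsPendent T z ∧ T.Adj x z}.ncard = (q + 1) / 2
  · exact nonempty_iso_doubleStarPath hT hux hup hxp (hcov (by omega)) h1.1 h1.2 (by omega)
  by_cases h2 : {z | IsPendent T z ∧ T.Adj x z}.ncard = q / 2 ∧
      {z | IsPendent T z ∧ T.Adj u z}.ncard = (q + 1) / 2
  · exact nonempty_iso_doubleStarPath hT hux.symm hxp hup
      (fun z hz => (hcov (by omega) z hz).symm) h2.1 h2.2 (by omega)
  exfalso
  obtain ⟨hq1, hr⟩ : q = 2 * a + 1 ∧ edgeDivision T (a + 1) ≤ 1 := by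
    rcases hqa with h | h
    · omega
    · exact h
  have hmu := edgeMu_mk T u v
  have hmx := edgeMu_mk T x y
  -- Both edges now have `μ = a + 1`, so they coincide; then the two sides make up `T` and `n = 2a +
  -- 2 = q + 1`, too small.
  have heq : s(u, v) = s(x, y) := (Set.ncard_le_one (Set.toFinite _)).1 hr _
    ⟨huv, by omega⟩ _ ⟨hxy, by omega⟩
  rcases Sym2.eq_iff.1 heq with ⟨h, -⟩ | ⟨rfl, rfl⟩
  · exact hux h
  · have := ncard_side_add hT huv
    omega

end EdgeDivision

/-! ### The theorem -/

open EdgeDivision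

theorem mainTheorem4 (n q : ℕ) (hq : 2 < q) (hqn : q < n - 1) :
    IsTreeWithPendents n q (doubleStarPath (n - q) (q / 2) ((q + 1) / 2)) ∧
    ∀ (V : Type*) (T : SimpleGraph V), IsTreeWithPendents n q T →
      EdgeDivisionLE n T (doubleStarPath (n - q) (q / 2) ((q + 1) / 2)) ∧
      (EdgeDivisionEq n T (doubleStarPath (n - q) (q / 2) ((q + 1) / 2)) ↔
        Nonempty (T ≃g doubleStarPath (n - q) (q / 2) ((q + 1) / 2))) := by
  have hCP : IsTreeWithPendents n q (doubleStarPath (n - q) (q / 2) ((q + 1) / 2)) := by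
    have h1 : q / 2 + (q + 1) / 2 = q := by omega
    have h2 : n - q + q = n := by omega
    have := dsp_isTreeWithPendents (k := n - q) (a := q / 2) (b := (q + 1) / 2) (by omega)
      (by omega) (by omega)
    rwa [h1, h2] at this
  refine ⟨hCP, fun V T hT => ?_⟩
  have := hT.finite
  have hTt := hT.isTree
  have hTn := hT.card_vertices
  have hTp := hT.card_pendent
  refine ⟨fun k hk => ?_, fun heq => ?_, fun ⟨φ⟩ i _ => edgeDivision_iso φ i⟩
  · have h1 := sum_edgeDivision hTt k
    have h2 := sum_edgeDivision hCP.isTree k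
    rw [hTn] at h1
    rw [hCP.card_vertices] at h2
    rw [h1, h2]
    -- For `k = 1` both tails count all `n - 1` edges; the lower bound for the double star path
    -- counts path edges only and serves `k ≥ 2`.
    rcases (Finset.mem_Icc.1 hk).1.eq_or_lt with rfl | hk2
    · rw [heavyEdges_one, heavyEdges_one]
      have h3 := ncard_edgeSet hTt
      have h4 := ncard_edgeSet hCP.isTree
      rw [hTn] at h3
      rw [hCP.card_vertices] at h4
      omega
    · rcases (heavyEdges T k).eq_empty_or_nonempty with he | hne
      · simp [he]
      · have h3 := ncard_heavyEdges_add_le hTt hne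
        have h4 := ncard_heavyEdges_two hTt (by omega)
        have h5 := Set.ncard_le_ncard (heavyEdges_anti (T := T) (show 2 ≤ k from hk2)) (Set.toFinite _)
        exact le_ncard_heavyEdges_dsp (by omega) (by omega) (by omega) (by omega)
  -- An edge of `T` with `2 ≤ μ ≤ q / 2` would force one with the same `μ` in the double star path,
  -- which has none.
  · have hheavy : ∀ e ∈ heavyEdges T 2, q / 2 + 1 ≤ edgeMu T e := by
      intro e he
      by_contra hlt
      have h2 := he.2
      have h3 := heq (edgeMu T e) (Finset.mem_Icc.2 ⟨by omega, by omega⟩)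
      have h4 : 0 < edgeDivision T (edgeMu T e) :=
        (Set.ncard_pos (Set.toFinite _)).2 ⟨e, he.1, rfl⟩
      rw [h3] at h4
      obtain ⟨f, hf, hfm⟩ := (Set.ncard_pos (Set.toFinite _)).1 h4
      have h5 : f ∈ heavyEdges (doubleStarPath (n - q) (q / 2) ((q + 1) / 2)) 2 :=
        ⟨hf, h2.trans_eq hfm.symm⟩
      rw [dsp_heavyEdges_eq (by omega) (by omega) (by omega)] at h5
      have h6 := h5.2
      omega
    rw [← hTn]
    refine nonempty_iso_of_heavyEdges hTt (a := q / 2) (by omega) hTp (by omega) hheavy ?_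
    rcases Nat.even_or_odd' q with ⟨c, rfl | rfl⟩
    · exact Or.inl (by omega)
    · refine Or.inr ⟨by omega, ?_⟩
      rw [heq _ (Finset.mem_Icc.2 ⟨by omega, by omega⟩)]
      exact dsp_edgeDivision_le_one (by omega) (by omega) (by omega)
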